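/- Let $n\ge 2$ and let $|\cdot|$ denote the Euclidean norm. A \emph{majorant} is a continuous nondecreasing function $\omega:[0,\infty)\to[0,\infty)$ with $\omega(0)=0$ such that $\omega(t)/t$ is non-increasing for $t>0$. For a set $G\subset\mathbb{R}^n$, $\Lambda_\omega(G)$ is the set of functions $f$ from $G$ to $\mathbb{R}^m$ ($m\ge1$) for which there is a constant $C>0$ with $|f(x)-f(y)|\le C\,\omega(|x-y|)$ for all $x,y\in G$. For a domain $G\subsetneq\mathbb{R}^n$ (non-empty, open, connected), $d_G(x)$ is the Euclidean distance from $x$ to $\partial G$, and $\mathrm{loc}\Lambda_\omega(G)$ is the set of functions $f:G\to\mathbb{R}^m$ for which there is a constant $C>0$ such that $|f(x)-f(y)|\le C\,\omega(|x-y|)$ for all $x,y\in G$ with $|x-y|<\frac12 d_G(x)$. The domain $G\subsetneq\mathbb{R}^n$ is a \emph{$\Lambda_\omega$-extension domain} if $\Lambda_\omega(G)=\mathrm{loc}\Lambda_\omega(G)$ (for every $m\ge1$). \textbf{Theorem.} Let $\omega$ be a majorant for which there are constants $\delta_0>0$ and $C_0>0$ with $$\int_0^\delta\frac{\omega(t)}{t}\,dt\le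 C_0\,\omega(\delta)\qquad(0<\delta<\delta_0),$$ let $\Omega$ be a $\Lambda_\omega$-extension domain in $\mathbb{R}^n$, and let $f:\Omega\to\mathbb{R}$ be harmonic. Then $f\in\Lambda_\omega(\Omega)$ if and only if there is a constant $C>0$ such that $$|\nabla f(x)|\le C\,\frac{\omega(d_\Omega(x))}{d_\Omega(x)}\qquad\text{for all }x\in\Omega.$$ -/

import Mathlib

/-- A majorant: a continuous, nondecreasing function `ω : [0,∞) → [0,∞)` with `ω 0 = 0` such that
`ω t / t` is non-increasing for `t > 0`.  Only the values of `ω` on `[0,∞)` matter. -/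
structure IsMajorant (ω : ℝ → ℝ) : Prop where
  continuousOn : ContinuousOn ω (Set.Ici 0)
  nonneg : ∀ t, 0 ≤ t → 0 ≤ ω t
  monotoneOn : MonotoneOn ω (Set.Ici 0)
  map_zero : ω 0 = 0
  antitoneOn_div : AntitoneOn (fun t => ω t / t) (Set.Ioi 0)

/-- The Dini-type condition: for some `δ₀ > 0` and `C > 0`, the integral `∫₀^δ ω(t)/t dt` is finite
and at most `C * ω δ` whenever `0 < δ < δ₀`. -/
def DiniCondition (ω : ℝ → ℝ) : Prop :=
  ∃ δ₀ > 0, ∃ C > 0, ∀ δ, 0 < δ → δ < δ₀ →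
    IntervalIntegrable (fun t => ω t / t) MeasureTheory.volume 0 δ ∧
      ∫ t in (0 : ℝ)..δ, ω t / t ≤ C * ω δ

/-- The Euclidean distance `d_Ω(x)` from `x` to the boundary of `Ω`. -/
noncomputable def bdryDist {n : ℕ} (Ω : Set (EuclideanSpace ℝ (Fin n)))
    (x : EuclideanSpace ℝ (Fin n)) : ℝ :=
  Metric.infDist x (frontier Ω)

/-- The Lipschitz space `Λ_ω(G)` of `F`-valued functions.  Functions are total, but only their
values on `G` matter. -/
def lipschitzSpace {n : ℕ} (ω : ℝ → ℝ) (G : Set (EuclideanSpace ℝ (Fin n)))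
    (F : Type*) [NormedAddCommGroup F] : Set (EuclideanSpace ℝ (Fin n) → F) :=
  {f | ∃ C > 0, ∀ x ∈ G, ∀ y ∈ G, ‖f x - f y‖ ≤ C * ω ‖x - y‖}

/-- The local Lipschitz space `loc Λ_ω(G)` of `F`-valued functions. -/
def locLipschitzSpace {n : ℕ} (ω : ℝ → ℝ) (G : Set (EuclideanSpace ℝ (Fin n)))
    (F : Type*) [NormedAddCommGroup F] : Set (EuclideanSpace ℝ (Fin n) → F) :=
  {f | ∃ C > 0, ∀ x ∈ G, ∀ y ∈ G, ‖x - y‖ < 1 / 2 * bdryDist G x →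
    ‖f x - f y‖ ≤ C * ω ‖x - y‖}

/-- A `Λ_ω`-extension domain: a proper subdomain `G` of `ℝⁿ` with `Λ_ω(G) = loc Λ_ω(G)`, for
functions with values in `ℝᵐ`, `m ≥ 1`. -/
structure IsLipschitzExtensionDomain {n : ℕ} (ω : ℝ → ℝ)
    (G : Set (EuclideanSpace ℝ (Fin n))) : Prop where
  isOpen : IsOpen G
  isConnected : IsConnected G
  ne_univ : G ≠ Set.univ
  lipschitzSpace_eq : ∀ m : ℕ, 1 ≤ m →
    lipschitzSpace ω G (EuclideanSpace ℝ (Fin m)) =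
      locLipschitzSpace ω G (EuclideanSpace ℝ (Fin m))

/-! If `f ∈ Λ_ω`, its oscillation on the half ball about `x` is at most `C ω(d)`, `d = d_Ω(x)`, and
the gradient estimate for harmonic functions divides this by a multiple of `d`. Conversely, the
gradient bound and the monotonicity of `ω t / t` give `f ∈ loc Λ_ω` by the mean value inequality on
half balls; the extension property makes this global.

The gradient estimate (`HarmonicOnNhd.norm_fderiv_le`) comes from a mean value property with weight
`k(y) = (1 - ‖y‖²)₊`. Since `k(y) y = -¼ ∇(k²)(y)`, integration by parts turns the radial derivative
of the average into an integral of the Laplacian. Then `f(x+v) - f(x)` is an integral against a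
difference of two translates of `k`, and `k` is Lipschitz. -/

open MeasureTheory Metric Set Filter Topology InnerProductSpace

/-! ### Weighted mean values and the gradient estimate -/

section GradientEstimate

variable {E : Type*} [NormedAddCommGroup E]

/-- The radial kernel `y ↦ (1 - ‖y‖²)₊`. -/
noncomputable def radialKernel (y : E) : ℝ := max 0 (1 - ‖y‖ ^ 2)

lemma continuous_radialKernel : Continuous (radialKernel : E → ℝ) := by
  unfold radialKernel; fun_prop

lemma radialKernel_nonneg (y : E) : 0 ≤ radialKernel y := le_max_left _ _

lemma radialKernel_eq_zero {y : E} (hy : 1 ≤ ‖y‖) : radialKernel y = 0 :=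
  max_eq_left (by nlinarith)

lemma abs_radialKernel_sub_le (y z : E) :
    |radialKernel y - radialKernel z| ≤ 2 * ‖y - z‖ := by
  have key : ∀ y z : E, radialKernel y - radialKernel z ≤ 2 * ‖y - z‖ := by
    intro y z
    rcases le_or_gt 1 ‖y‖ with hy | hy
    · rw [radialKernel_eq_zero hy]
      linarith [radialKernel_nonneg z, norm_nonneg (y - z)]
    · have h1 : radialKernel y = 1 - ‖y‖ ^ 2 := max_eq_right (by nlinarith [norm_nonneg y])
      have h3 : ‖z‖ - ‖y‖ ≤ ‖y - z‖ := by rw [norm_sub_rev]; exact norm_sub_norm_le z y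
      rcases le_or_gt 1 ‖z‖ with hz | hz
      · rw [radialKernel_eq_zero hz, h1]
        nlinarith [norm_nonneg y]
      · have h2 : 1 - ‖z‖ ^ 2 ≤ radialKernel z := le_max_right _ _
        nlinarith [norm_nonneg y, norm_nonneg z, norm_nonneg (y - z)]
  rw [abs_le]
  constructor
  · have := key z y
    rw [norm_sub_rev] at this
    linarith
  · exact key y z

/-- Squaring removes the corner of the positive part, so the squared kernel is differentiable across
the unit sphere. -/
lemma hasDerivAt_max_zero_sq (s : ℝ) :
    HasDerivAt (fun s : ℝ => max 0 s ^ 2) (2 * max 0 s) s := by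
  rcases lt_trichotomy s 0 with hs | hs | hs
  · rw [max_eq_left hs.le, mul_zero]
    refine (hasDerivAt_const s (0 : ℝ)).congr_of_eventuallyEq ?_
    filter_upwards [Iio_mem_nhds hs] with t ht
    rw [max_eq_left (le_of_lt ht)]; simp
  · subst hs
    rw [max_self, mul_zero, hasDerivAt_iff_isLittleO_nhds_zero]
    have h1 : (fun h : ℝ => h ^ 2) =o[𝓝 0] fun h : ℝ => h := by
      simpa using Asymptotics.isLittleO_pow_id (𝕜 := ℝ) (n := 2) (by norm_num)
    refine Asymptotics.IsBigO.trans_isLittleO (Asymptotics.IsBigO.of_bound 1 ?_) h1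
    filter_upwards with h
    rcases le_total h 0 with hh | hh
    · simp [max_eq_left hh, sq_nonneg]
    · simp [max_eq_right hh]
  · rw [max_eq_right hs.le]
    have := (hasDerivAt_pow 2 s)
    refine HasDerivAt.congr_of_eventuallyEq (by simpa using this) ?_
    filter_upwards [Ioi_mem_nhds hs] with t ht
    rw [max_eq_right (le_of_lt ht)]

variable [InnerProductSpace ℝ E]

lemma hasFDerivAt_radialKernel_sq (y : E) :
    HasFDerivAt (fun y : E => radialKernel y ^ 2) ((-4 * radialKernel y) • innerSL ℝ y) y := by
  have h1 : HasFDerivAt (fun y : E => 1 - ‖y‖ ^ 2) (-(2 • innerSL ℝ y)) y :=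
    (hasStrictFDerivAt_norm_sq y).hasFDerivAt.const_sub 1
  have h2 := (hasDerivAt_max_zero_sq (1 - ‖y‖ ^ 2)).comp_hasFDerivAt y h1
  refine h2.congr_fderiv ?_
  ext v
  simp [radialKernel]
  ring

variable [FiniteDimensional ℝ E]

lemma hasCompactSupport_radialKernel : HasCompactSupport (radialKernel : E → ℝ) := by
  refine HasCompactSupport.intro (isCompact_closedBall (0 : E) 1) fun y hy => ?_
  rw [mem_closedBall_zero_iff, not_le] at hy
  exact radialKernel_eq_zero hy.le

/-- A harmonic function agrees on a ball with a compactly supported `C²` function. -/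
lemma exists_contDiff_eqOn_ball {f : E → ℝ} {x : E} {d ρ : ℝ} (hρ : 0 < ρ) (hρd : ρ < d)
    (hf : HarmonicOnNhd f (ball x d)) :
    ∃ F : E → ℝ, ContDiff ℝ 2 F ∧ HasCompactSupport F ∧ EqOn F f (ball x ρ) ∧
      ∀ y ∈ ball x ρ, Laplacian.laplacian F y = 0 := by
  -- The outer radius lies strictly between `ρ` and `d`, so `χ * f` is `C²` everywhere, whatever `f`
  -- does outside the ball of radius `d`.
  let χ : ContDiffBump x := ⟨ρ, (ρ + d) / 2, hρ, by linarith⟩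
  have heq : EqOn (fun y => χ y * f y) f (ball x ρ) := fun y hy => by
    simp [χ.one_of_mem_closedBall (ball_subset_closedBall hy)]
  refine ⟨fun y => χ y * f y, ?_, χ.hasCompactSupport.mul_right, heq, fun y hy => ?_⟩
  · refine contDiff_iff_contDiffAt.2 fun y => ?_
    by_cases hy : y ∈ ball x d
    · exact χ.contDiff.contDiffAt.mul (hf y hy).1
    · have hy' : y ∉ tsupport χ := by
        rw [χ.tsupport_eq]
        intro h
        exact hy (closedBall_subset_ball (by simp only [χ]; linarith) h)
      refine (contDiffAt_const (c := (0 : ℝ))).congr_of_eventuallyEq ?_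
      filter_upwards [notMem_tsupport_iff_eventuallyEq.1 hy'] with z hz
      simp [hz]
  · rw [(laplacian_congr_nhds (heq.eventuallyEq_of_mem (isOpen_ball.mem_nhds hy))).self_of_nhds]
    exact (hf y (ball_subset_ball hρd.le hy)).2.self_of_nhds

variable [MeasurableSpace E] [BorelSpace E]

lemma integral_radialKernel_pos : 0 < ∫ y : E, radialKernel y := by
  refine continuous_radialKernel.integral_pos_of_hasCompactSupport_nonneg_nonzero
    hasCompactSupport_radialKernel radialKernel_nonneg (x := 0) ?_
  simp [radialKernel]

lemma integrable_mul_radialKernel {u : E → ℝ} (hu : Continuous u) :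
    Integrable fun y => u y * radialKernel y :=
  (hu.mul continuous_radialKernel).integrable_of_hasCompactSupport
    hasCompactSupport_radialKernel.mul_left

lemma integrable_mul_radialKernel_sq {u : E → ℝ} (hu : Continuous u) :
    Integrable fun y => u y * radialKernel y ^ 2 := by
  have := integrable_mul_radialKernel (hu.mul continuous_radialKernel)
  refine this.congr (ae_of_all _ fun y => ?_)
  simp only [Pi.mul_apply]
  ring

/-- Differentiation of the radial averages of `F` with respect to the radius. -/
lemma hasDerivAt_integral_mul_radialKernel {F : E → ℝ} (hF : ContDiff ℝ 2 F)
    (hc : HasCompactSupport F) (x : E) (t : ℝ) :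
    HasDerivAt (fun t : ℝ => ∫ y, F (x + t • y) * radialKernel y)
      (∫ y, fderiv ℝ F (x + t • y) y * radialKernel y) t := by
  have hF' : Continuous (fderiv ℝ F) := hF.continuous_fderiv (by norm_num)
  obtain ⟨K, hK⟩ := (hc.fderiv ℝ).exists_bound_of_continuous hF'
  have hcont : ∀ s : ℝ, Continuous fun y => F (x + s • y) := fun s =>
    hF.continuous.comp (by fun_prop)
  have hcont' : Continuous fun y => fderiv ℝ F (x + t • y) y :=
    (hF'.comp (by fun_prop : Continuous fun y : E => x + t • y)).clm_apply continuous_id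
  refine (hasDerivAt_integral_of_dominated_loc_of_deriv_le (s := univ)
    (F' := fun s y => fderiv ℝ F (x + s • y) y * radialKernel y)
    (bound := fun y => K * radialKernel y) univ_mem ?_ ?_ ?_ ?_ ?_ ?_).2
  · exact Eventually.of_forall fun s => (integrable_mul_radialKernel (hcont s)).aestronglyMeasurable
  · exact integrable_mul_radialKernel (hcont t)
  · exact (integrable_mul_radialKernel hcont').aestronglyMeasurable
  · refine ae_of_all _ fun y s _ => ?_
    rcases le_or_gt 1 ‖y‖ with hy | hy
    · simp [radialKernel_eq_zero hy]
    · rw [norm_mul, Real.norm_of_nonneg (radialKernel_nonneg y)]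
      refine mul_le_mul_of_nonneg_right ?_ (radialKernel_nonneg y)
      calc ‖fderiv ℝ F (x + s • y) y‖ ≤ ‖fderiv ℝ F (x + s • y)‖ * ‖y‖ :=
            ContinuousLinearMap.le_opNorm _ _
        _ ≤ ‖fderiv ℝ F (x + s • y)‖ * 1 := by gcongr
        _ ≤ K := by rw [mul_one]; exact hK _
  · exact integrable_mul_radialKernel continuous_const
  · refine ae_of_all _ fun y s _ => HasDerivAt.mul_const ?_ _
    have h1 : HasDerivAt (fun s : ℝ => x + s • y) y s := by
      simpa using ((hasDerivAt_id s).smul_const y).const_add x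
    exact ((hF.differentiable (by norm_num)) _).hasFDerivAt.comp_hasDerivAt s h1

/-- The divergence theorem for the gradient of `F`, weighted by the radial kernel. -/
lemma integral_fderiv_mul_radialKernel {F : E → ℝ} (hF : ContDiff ℝ 2 F) (x : E) (t : ℝ) :
    ∫ y, fderiv ℝ F (x + t • y) y * radialKernel y =
      t / 4 * ∫ y, Laplacian.laplacian F (x + t • y) * radialKernel y ^ 2 := by
  set b := stdOrthonormalBasis ℝ E
  have hF1 : ContDiff ℝ 1 (fderiv ℝ F) := hF.fderiv_right (by norm_num)
  have hF2 : Continuous (fderiv ℝ (fderiv ℝ F)) := hF1.continuous_fderiv (by norm_num)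
  have haff : Continuous fun y : E => x + t • y := by fun_prop
  have hu : ∀ i y, HasFDerivAt (fun y => fderiv ℝ F (x + t • y) (b i))
      (t • (fderiv ℝ (fderiv ℝ F) (x + t • y)).flip (b i)) y := by
    intro i y
    have h1 : HasFDerivAt (fun y : E => x + t • y) (t • ContinuousLinearMap.id ℝ E) y :=
      ((hasFDerivAt_id y).const_smul t).const_add x
    have h2 := (((hF1.differentiable (by norm_num)) (x + t • y)).hasFDerivAt.comp y h1).clm_apply
      (hasFDerivAt_const (b i) y)
    refine h2.congr_fderiv ?_
    ext v
    simp
  have hcu : ∀ i, Continuous fun y => fderiv ℝ F (x + t • y) (b i) := fun i =>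
    (hF1.continuous.comp haff).clm_apply continuous_const
  have hcu' : ∀ i, Continuous fun y => fderiv ℝ (fderiv ℝ F) (x + t • y) (b i) (b i) := fun i =>
    ((hF2.comp haff).clm_apply continuous_const).clm_apply continuous_const
  have hparts : ∀ i, ∫ y, (fderiv ℝ F (x + t • y) (b i) * inner ℝ y (b i)) * radialKernel y =
      t / 4 * ∫ y, fderiv ℝ (fderiv ℝ F) (x + t • y) (b i) (b i) * radialKernel y ^ 2 := by
    intro i
    have hk : ∀ y : E, fderiv ℝ (fun y : E => radialKernel y ^ 2) y (b i) =
        -4 * radialKernel y * inner ℝ y (b i) := fun y => by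
      rw [(hasFDerivAt_radialKernel_sq y).fderiv]; simp
    have hud : ∀ y, fderiv ℝ (fun y => fderiv ℝ F (x + t • y) (b i)) y (b i) =
        t * fderiv ℝ (fderiv ℝ F) (x + t • y) (b i) (b i) := fun y => by
      rw [(hu i y).fderiv]; simp
    -- Integration by parts along `b i`; the factors `-4` (from the squared kernel) and `t` (chain
    -- rule) combine to `t / 4`.
    have hmain := integral_mul_fderiv_eq_neg_fderiv_mul_of_integrable (μ := (volume : Measure E))
      (f := fun y => fderiv ℝ F (x + t • y) (b i)) (g := fun y : E => radialKernel y ^ 2)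
      (v := b i) ?_ ?_ ?_ (fun y _ => (hu i y).differentiableAt)
      (fun y _ => (hasFDerivAt_radialKernel_sq y).differentiableAt)
    · simp only [hk, hud] at hmain
      have e1 : ∀ y, fderiv ℝ F (x + t • y) (b i) * (-4 * radialKernel y * inner ℝ y (b i)) =
        -4 * ((fderiv ℝ F (x + t • y) (b i) * inner ℝ y (b i)) * radialKernel y) := fun y => by ring
      simp only [e1, mul_assoc t, integral_const_mul] at hmain
      linarith
    · simp only [hud]
      exact integrable_mul_radialKernel_sq (continuous_const.mul (hcu' i))
    · simp only [hk]
      have := (integrable_mul_radialKernel ((hcu i).mul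
        (continuous_id.inner continuous_const : Continuous fun y : E => inner ℝ y (b i)))).const_mul
        (-4)
      refine this.congr (ae_of_all _ fun y => ?_)
      simp only [Pi.mul_apply, id]
      ring
    · exact integrable_mul_radialKernel_sq (hcu i)
  have hL : ∀ y, Laplacian.laplacian F (x + t • y) * radialKernel y ^ 2 =
      ∑ i, fderiv ℝ (fderiv ℝ F) (x + t • y) (b i) (b i) * radialKernel y ^ 2 := by
    intro y
    rw [laplacian_eq_iteratedFDeriv_orthonormalBasis F b, Finset.sum_mul]
    simp [iteratedFDeriv_two_apply]
  have hD : ∀ y, fderiv ℝ F (x + t • y) y * radialKernel y =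
      ∑ i, (fderiv ℝ F (x + t • y) (b i) * inner ℝ y (b i)) * radialKernel y := by
    intro y
    rw [← Finset.sum_mul]
    congr 1
    conv_lhs => arg 2; rw [← b.sum_repr' y]
    rw [map_sum]
    exact Finset.sum_congr rfl fun i _ => by
      rw [map_smul, smul_eq_mul, real_inner_comm, mul_comm]
  simp only [hL, hD]
  rw [integral_finsetSum, integral_finsetSum, Finset.mul_sum]
  · exact Finset.sum_congr rfl fun i _ => hparts i
  · exact fun i _ => integrable_mul_radialKernel_sq (hcu' i)
  · exact fun i _ => integrable_mul_radialKernel ((hcu i).mul (continuous_id.inner continuous_const))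

/-- The weighted mean value property. -/
lemma integral_mul_radialKernel_eq {F : E → ℝ} (hF : ContDiff ℝ 2 F) (hc : HasCompactSupport F)
    {x : E} {r : ℝ} (hr : 0 ≤ r) (hΔ : ∀ y ∈ ball x r, Laplacian.laplacian F y = 0) :
    ∫ y, F (x + r • y) * radialKernel y = F x * ∫ y : E, radialKernel y := by
  have hzero : ∀ t ∈ Ico 0 r, ∫ y, fderiv ℝ F (x + t • y) y * radialKernel y = 0 := by
    intro t ht
    rw [integral_fderiv_mul_radialKernel hF]
    have : ∀ y, Laplacian.laplacian F (x + t • y) * radialKernel y ^ 2 = 0 := by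
      intro y
      rcases le_or_gt 1 ‖y‖ with hy | hy
      · simp [radialKernel_eq_zero hy]
      · rw [hΔ, zero_mul]
        rw [mem_ball_iff_norm, add_sub_cancel_left, norm_smul, Real.norm_of_nonneg ht.1]
        nlinarith [ht.1, ht.2, norm_nonneg y]
    simp [this]
  -- The average is constant in the radius on `[0, r]`, and at radius `0` it is `F x` times the mass
  -- of the kernel.
  have hd := hasDerivAt_integral_mul_radialKernel hF hc x
  have := constant_of_has_deriv_right_zero (a := 0) (b := r)
    (fun t _ => (hd t).continuousAt.continuousWithinAt)
    (fun t ht => by have := (hd t).hasDerivWithinAt (s := Ici t); rwa [hzero t ht] at this)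
    r (right_mem_Icc.2 hr)
  simpa [integral_const_mul] using this

/-- A constant for the gradient estimate, depending only on the space. -/
noncomputable def gradientConst (E : Type*) [NormedAddCommGroup E] [InnerProductSpace ℝ E]
    [FiniteDimensional ℝ E] [MeasurableSpace E] [BorelSpace E] : ℝ :=
  2 * volume.real (ball (0 : E) 2) / ∫ y : E, radialKernel y

lemma gradientConst_nonneg : 0 ≤ gradientConst E :=
  div_nonneg (by positivity) integral_radialKernel_pos.le

/-- The averages of radius `r` about `x + v` and `x` integrate the same function `F (x + r • y)`
against kernels shifted by `w = v / r`, and these differ by at most `2 * ‖w‖`. -/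
lemma abs_sub_le_of_laplacian_eq_zero {F : E → ℝ} (hF : ContDiff ℝ 2 F)
    (hc : HasCompactSupport F) {x v : E} {r M : ℝ} (hv : ‖v‖ < r)
    (hΔ : ∀ y ∈ ball x (2 * r), Laplacian.laplacian F y = 0)
    (hM : ∀ y ∈ ball x (2 * r), |F y - F x| ≤ M) :
    |F (x + v) - F x| ≤ gradientConst E * M / r * ‖v‖ := by
  have hr : 0 < r := (norm_nonneg v).trans_lt hv
  have hM0 : 0 ≤ M := (abs_nonneg _).trans (hM x (mem_ball_self (by positivity)))
  set c := ∫ y : E, radialKernel y with hcdef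
  have hcpos : 0 < c := integral_radialKernel_pos
  set w := r⁻¹ • v
  have hw : ‖w‖ = ‖v‖ / r := by
    rw [norm_smul, norm_inv, Real.norm_of_nonneg hr.le, inv_mul_eq_div]
  have hw1 : ‖w‖ < 1 := by rw [hw, div_lt_one hr]; exact hv
  have hrw : r • w = v := smul_inv_smul₀ hr.ne' v
  have hcF : Continuous fun y => F (x + r • y) := hF.continuous.comp (by fun_prop)
  have h1 : ∫ y, F (x + r • y) * radialKernel (y - w) = F (x + v) * c := by
    rw [← integral_mul_radialKernel_eq hF hc (x := x + v) hr.le,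
      ← integral_add_right_eq_self _ w]
    · refine integral_congr_ae (ae_of_all _ fun y => ?_)
      simp only [add_sub_cancel_right, smul_add, hrw]
      rw [add_assoc, add_comm v]
    · intro y hy
      refine hΔ y ?_
      rw [mem_ball_iff_norm] at hy ⊢
      calc ‖y - x‖ = ‖(y - (x + v)) + v‖ := by congr 1; abel
        _ ≤ ‖y - (x + v)‖ + ‖v‖ := norm_add_le _ _
        _ < 2 * r := by linarith
  have h2 : ∫ y, F (x + r • y) * radialKernel y = F x * c :=
    integral_mul_radialKernel_eq hF hc hr.le fun y hy =>
      hΔ y (ball_subset_ball (by linarith) hy)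
  have h3 : ∫ y, radialKernel (y - w) = c := integral_sub_right_eq_self _ w
  have hi1 : ∀ {u : E → ℝ}, Continuous u → Integrable fun y => u y * radialKernel (y - w) := by
    intro u hu
    have := (integrable_mul_radialKernel (u := fun y => u (y + w)) (by fun_prop)).comp_sub_right w
    simpa using this
  -- Both kernels have mass `c`, so `F x` may be subtracted from the integrand; only the oscillation
  -- of `F` enters.
  have h4 : (F (x + v) - F x) * c =
      ∫ y, (F (x + r • y) - F x) * (radialKernel (y - w) - radialKernel y) := by
    have e : ∀ y, (F (x + r • y) - F x) * (radialKernel (y - w) - radialKernel y) =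
        (F (x + r • y) * radialKernel (y - w) - F x * radialKernel (y - w)) -
          (F (x + r • y) * radialKernel y - F x * radialKernel y) := fun y => by ring
    simp only [e]
    rw [integral_sub, integral_sub (hi1 hcF) (hi1 continuous_const),
      integral_sub (integrable_mul_radialKernel hcF) (integrable_mul_radialKernel continuous_const),
      integral_const_mul, integral_const_mul, h1, h2, h3]
    · ring
    · exact (hi1 hcF).sub (hi1 continuous_const)
    · exact (integrable_mul_radialKernel hcF).sub (integrable_mul_radialKernel continuous_const)
  -- As `‖w‖ < 1`, both kernels vanish outside the ball of radius `2`.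
  have h5 : |(F (x + v) - F x) * c| ≤ M * (2 * ‖w‖) * volume.real (ball (0 : E) 2) := by
    rw [h4, ← setIntegral_eq_integral_of_forall_compl_eq_zero (s := ball (0 : E) 2),
      ← Real.norm_eq_abs]
    · refine norm_setIntegral_le_of_norm_le_const measure_ball_lt_top fun y hy => ?_
      rw [mem_ball_zero_iff] at hy
      rw [norm_mul]
      refine mul_le_mul (hM _ ?_) ?_ (norm_nonneg _) hM0
      · rw [mem_ball_iff_norm, add_sub_cancel_left, norm_smul, Real.norm_of_nonneg hr.le]
        nlinarith
      · refine (abs_radialKernel_sub_le _ _).trans_eq ?_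
        simp
    · intro y hy
      rw [mem_ball_zero_iff, not_lt] at hy
      have : 1 ≤ ‖y - w‖ := by linarith [norm_sub_norm_le y w]
      rw [radialKernel_eq_zero this, radialKernel_eq_zero (by linarith), sub_zero, mul_zero]
  rw [abs_mul, abs_of_pos hcpos, ← le_div_iff₀ hcpos] at h5
  refine h5.trans_eq ?_
  rw [hw, gradientConst, ← hcdef]
  ring

/-- The gradient estimate for harmonic functions. -/
theorem InnerProductSpace.HarmonicOnNhd.norm_fderiv_le {f : E → ℝ} {x : E} {d r M : ℝ}
    (hr : 0 < r) (hrd : 2 * r < d) (hf : HarmonicOnNhd f (ball x d))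
    (hM : ∀ y ∈ ball x (2 * r), |f y - f x| ≤ M) :
    ‖fderiv ℝ f x‖ ≤ gradientConst E * M / r := by
  have hx : x ∈ ball x (2 * r) := mem_ball_self (by positivity)
  have hM0 : 0 ≤ M := (abs_nonneg _).trans (hM x hx)
  obtain ⟨F, hF, hc, heq, hΔ⟩ := exists_contDiff_eqOn_ball (by positivity) hrd hf
  have hdiff : DifferentiableAt ℝ f x :=
    (hf x (ball_subset_ball hrd.le hx)).1.differentiableAt (by norm_num)
  refine hdiff.hasFDerivAt.le_of_lip'
    (div_nonneg (mul_nonneg gradientConst_nonneg hM0) hr.le) ?_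
  filter_upwards [ball_mem_nhds x hr] with z hz
  have h := abs_sub_le_of_laplacian_eq_zero (v := z - x) hF hc (mem_ball_iff_norm.1 hz) hΔ
    fun y hy => by rw [heq hy, heq hx]; exact hM y hy
  rwa [add_sub_cancel, heq hx, heq (ball_subset_ball (by linarith) hz)] at h

end GradientEstimate

/-! ### Boundary distance and the two implications -/

section Domain

variable {n : ℕ} {Ω : Set (EuclideanSpace ℝ (Fin n))}

lemma frontier_nonempty_of_mem {x : EuclideanSpace ℝ (Fin n)} (hne : Ω ≠ univ) (hx : x ∈ Ω) :
    (frontier Ω).Nonempty :=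
  nonempty_frontier_iff.2 ⟨⟨x, hx⟩, hne⟩

lemma bdryDist_pos {x : EuclideanSpace ℝ (Fin n)} (ho : IsOpen Ω) (hne : Ω ≠ univ) (hx : x ∈ Ω) :
    0 < bdryDist Ω x := by
  refine (isClosed_frontier.notMem_iff_infDist_pos (frontier_nonempty_of_mem hne hx)).1 fun h => ?_
  rw [ho.frontier_eq] at h
  exact h.2 hx

/-- The ball misses the frontier, so a point outside `Ω` would split this connected set between the
open sets `Ω` and `(closure Ω)ᶜ`. -/
lemma ball_bdryDist_subset {x : EuclideanSpace ℝ (Fin n)} (ho : IsOpen Ω) (hx : x ∈ Ω) :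
    ball x (bdryDist Ω x) ⊆ Ω := by
  have hdisj : ∀ y ∈ ball x (bdryDist Ω x), y ∉ frontier Ω := fun y hy hyf => by
    rw [mem_ball, dist_comm] at hy
    exact absurd (infDist_le_dist_of_mem (x := x) hyf) (not_le.2 hy)
  have hcl : ∀ y ∈ ball x (bdryDist Ω x), y ∉ Ω → y ∈ (closure Ω)ᶜ := fun y hy hyΩ hyc =>
    hdisj y hy (by rw [ho.frontier_eq]; exact ⟨hyc, hyΩ⟩)
  by_contra hsub
  obtain ⟨z, hz, hzΩ⟩ := not_subset.1 hsub
  obtain ⟨y, -, hyΩ, hyc⟩ := (convex_ball x (bdryDist Ω x)).isPreconnected Ω (closure Ω)ᶜ ho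
    isClosed_closure.isOpen_compl
    (fun y hy => (em (y ∈ Ω)).imp_right (hcl y hy))
    ⟨x, mem_ball_self (pos_of_mem_ball hz), hx⟩ ⟨z, hz, hcl z hz hzΩ⟩
  exact hyc (subset_closure hyΩ)

lemma norm_gradient_eq (f : EuclideanSpace ℝ (Fin n) → ℝ) (x : EuclideanSpace ℝ (Fin n)) :
    ‖gradient f x‖ = ‖fderiv ℝ f x‖ := by
  rw [gradient, LinearIsometryEquiv.norm_map]

lemma exists_gradient_bound_of_mem_lipschitzSpace {ω : ℝ → ℝ} (hω : IsMajorant ω) (ho : IsOpen Ω)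
    (hne : Ω ≠ univ) {f : EuclideanSpace ℝ (Fin n) → ℝ} (hf : HarmonicOnNhd f Ω)
    (hfl : f ∈ lipschitzSpace ω Ω ℝ) :
    ∃ C > 0, ∀ x ∈ Ω, ‖gradient f x‖ ≤ C * (ω (bdryDist Ω x) / bdryDist Ω x) := by
  obtain ⟨C, hC, hle⟩ := hfl
  set A := gradientConst (EuclideanSpace ℝ (Fin n))
  have hA : 0 ≤ A := gradientConst_nonneg
  -- The `4` comes from the choice `r = d / 4`; the `+ 1` makes the constant positive, since `A * C`
  -- is only known to be nonnegative.
  refine ⟨4 * A * C + 1, by positivity, fun x hx => ?_⟩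
  have hd := bdryDist_pos ho hne hx
  have hsub := ball_bdryDist_subset ho hx
  set d := bdryDist Ω x
  have hω0 := hω.nonneg d hd.le
  have h := (hf.mono hsub).norm_fderiv_le (r := d / 4) (M := C * ω d) (by positivity)
    (by linarith) fun y hy => by
      have hyd : ‖y - x‖ ≤ d := by rw [mem_ball_iff_norm] at hy; linarith
      have hyΩ : y ∈ Ω := hsub (ball_subset_ball (by linarith) hy)
      refine (hle y hyΩ x hx).trans ?_
      gcongr
      exact hω.monotoneOn (norm_nonneg _) hd.le hyd
  rw [norm_gradient_eq]
  calc ‖fderiv ℝ f x‖ ≤ A * (C * ω d) / (d / 4) := h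
    _ = 4 * A * C * (ω d / d) := by field_simp
    _ ≤ (4 * A * C + 1) * (ω d / d) := by gcongr; linarith

lemma mem_locLipschitzSpace_of_gradient_bound {ω : ℝ → ℝ} (hω : IsMajorant ω) (ho : IsOpen Ω)
    (hne : Ω ≠ univ) {f : EuclideanSpace ℝ (Fin n) → ℝ}
    (hf : ∀ x ∈ Ω, DifferentiableAt ℝ f x) {C : ℝ} (hC : 0 < C)
    (hle : ∀ x ∈ Ω, ‖gradient f x‖ ≤ C * (ω (bdryDist Ω x) / bdryDist Ω x)) :
    f ∈ locLipschitzSpace ω Ω ℝ := by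
  refine ⟨C, hC, fun x hx y hy hxy => ?_⟩
  rcases eq_or_ne x y with rfl | hne'
  · simp [hω.map_zero]
  have hd := bdryDist_pos ho hne hx
  have hsub : ball x (bdryDist Ω x / 2) ⊆ Ω :=
    (ball_subset_ball (by linarith)).trans (ball_bdryDist_subset ho hx)
  have hpos : 0 < ‖x - y‖ := norm_pos_iff.2 (sub_ne_zero.2 hne')
  have hyb : y ∈ ball x (bdryDist Ω x / 2) := by
    rw [mem_ball_iff_norm, norm_sub_rev]; linarith
  have hbound : ∀ z ∈ ball x (bdryDist Ω x / 2),
      ‖fderiv ℝ f z‖ ≤ C * (ω ‖x - y‖ / ‖x - y‖) := by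
    intro z hz
    have hz1 : bdryDist Ω x ≤ bdryDist Ω z + dist x z := infDist_le_infDist_add_dist
    rw [mem_ball, dist_comm] at hz
    -- `d_Ω(z)` exceeds `d_Ω(x) / 2`, hence `‖x - y‖`, so the gradient bound at `z` is controlled by
    -- `ω t / t` at `t = ‖x - y‖`.
    have hz2 : ‖x - y‖ ≤ bdryDist Ω z := by linarith
    have hzΩ : z ∈ Ω := hsub (by rwa [mem_ball, dist_comm])
    rw [← norm_gradient_eq]
    refine (hle z hzΩ).trans ?_
    gcongr ?_ * ?_
    exact hω.antitoneOn_div hpos (hpos.trans_le hz2) hz2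
  have h := (convex_ball x (bdryDist Ω x / 2)).norm_image_sub_le_of_norm_fderiv_le
    (fun z hz => hf z (hsub hz)) hbound hyb (mem_ball_self (by positivity))
  refine h.trans_eq ?_
  field_simp

end Domain

theorem theorem1 (n : ℕ) (hn : 2 ≤ n) (ω : ℝ → ℝ) (hω : IsMajorant ω) (hDini : DiniCondition ω)
    (Ω : Set (EuclideanSpace ℝ (Fin n))) (hΩ : IsLipschitzExtensionDomain ω Ω)
    (f : EuclideanSpace ℝ (Fin n) → ℝ) (hf : InnerProductSpace.HarmonicOnNhd f Ω) :
    f ∈ lipschitzSpace ω Ω ℝ ↔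
      ∃ C > 0, ∀ x ∈ Ω, ‖gradient f x‖ ≤ C * (ω (bdryDist Ω x) / bdryDist Ω x) := by
  refine ⟨exists_gradient_bound_of_mem_lipschitzSpace hω hΩ.isOpen hΩ.ne_univ hf, ?_⟩
  rintro ⟨C, hC, hle⟩
  obtain ⟨C₁, hC₁, hloc⟩ := mem_locLipschitzSpace_of_gradient_bound hω hΩ.isOpen hΩ.ne_univ
    (fun x hx => (hf x hx).1.differentiableAt (by norm_num)) hC hle
  -- The extension property concerns `ℝᵐ`-valued maps; `f` is passed through the isometry of `ℝ`
  -- with `ℝ¹`.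
  have hnorm : ∀ x y, ‖EuclideanSpace.single (0 : Fin 1) (f x) -
      EuclideanSpace.single (0 : Fin 1) (f y)‖ = ‖f x - f y‖ := fun x y => by
    simp [EuclideanSpace.norm_eq, Real.sqrt_sq_eq_abs]
  have hmem : (fun x => EuclideanSpace.single (0 : Fin 1) (f x)) ∈
      locLipschitzSpace ω Ω (EuclideanSpace ℝ (Fin 1)) :=
    ⟨C₁, hC₁, fun x hx y hy hxy => by rw [hnorm]; exact hloc x hx y hy hxy⟩
  rw [← hΩ.lipschitzSpace_eq 1 le_rfl] at hmem
  obtain ⟨C₂, hC₂, h⟩ := hmem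
  exact ⟨C₂, hC₂, fun x hx y hy => by rw [← hnorm]; exact h x hx y hy⟩
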